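/- Let $A$ be a totally ordered alphabet, and order words over $A$ lexicographically (a proper prefix of a word is smaller than the word). A word $w$ is primitive if $w=z^n$ forces $n=1$; its conjugates are the words $vu$ with $w=uv$; a Lyndon word is a primitive word that is the smallest of its conjugates. The Burrows–Wheeler matrix of a primitive word $w$ has as its rows the conjugates of $w$ in increasing lexicographic order, and $w$ is perfectly clustering if it is primitive and the last column of this matrix, read from top to bottom, is weakly decreasing. A special palindromic factorization of a word $z$ is a factorization $z=a_1\pi_1a_2\pi_2\cdots\pi_{k-1}a_k$, where $a_1<a_2<\cdots<a_k$ are exactly the letters that occur in $z$ and $\pi_1,\ldots,\pi_{k-1}$ are (possibly empty) palindromes. Theorem. Let $w$ be a perfectly clustering word and let $z$ be the Lyndon word conjugate to $w$ (so $z=w$ if $w$ is a Lyndon word). Then $z$ has exactly one special palindromic factorization $z=a_1\pi_1a_2\cdots\pi_{k-1}a_k$, and for any two consecutive rows $w',w''$ of the Burrows–Wheeler matrix of $w$ there are words $x,y,m$ such that $$w'=y\,m\,x,\qquad w''=y\,\tilde m\,x,$$ where $\tilde m$ is the reversal of $m$, and such that $xy=\pi_i$ for some $i\in\{1,\ldots,k-1\}$.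 -/

import Mathlib

/-! Words over a totally ordered alphabet `α` are lists over `α`; lists carry the lexicographic
order of Mathlib (a proper prefix is smaller), and two words are conjugate when they are rotations
of each other (`List.IsRotated`, written `~r`). -/

namespace ClusteringWord

/-- A word is primitive if `w = z ^ n` forces `n = 1` (so the empty word is not primitive). -/
def IsPrimitive {α : Type*} (w : List α) : Prop :=
  ∀ (z : List α) (n : ℕ), w = (List.replicate n z).flatten → n = 1

/-- A Lyndon word: a primitive word that is lexicographically minimal among its conjugates. -/
def IsLyndon {α : Type*} [LinearOrder α] (w : List α) : Prop :=
  IsPrimitive w ∧ ∀ v : List α, v ~r w → w ≤ v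

/-- The rows of the Burrows–Wheeler matrix: the conjugates of `w`, in increasing
lexicographic order. -/
def bwRows {α : Type*} [LinearOrder α] (w : List α) : List (List α) :=
  w.cyclicPermutations.toFinset.sort (· ≤ ·)

/-- The Burrows–Wheeler transform: the last column of the Burrows–Wheeler matrix. -/
def bw {α : Type*} [LinearOrder α] (w : List α) : List α :=
  (bwRows w).filterMap List.getLast?

/-- A perfectly clustering word: a primitive word whose Burrows–Wheeler transform is
weakly decreasing. -/
def IsPerfectlyClustering {α : Type*} [LinearOrder α] (w : List α) : Prop :=
  IsPrimitive w ∧ (bw w).Pairwise (· ≥ ·)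

/-- The letters `a₁ < a₂ < ⋯ < a_k` that occur in `w`, in increasing order. -/
def letters {α : Type*} [LinearOrder α] (w : List α) : List α :=
  w.toFinset.sort (· ≤ ·)

/-- The word `a₁ π₁ a₂ π₂ ⋯ π_{k-1} a_k` built from the lists `[a₁, …, a_k]`
and `[π₁, …, π_{k-1}]`. -/
def interleave {α : Type*} : List α → List (List α) → List α
  | a :: as, p :: ps => a :: (p ++ interleave as ps)
  | as, [] => as
  | [], _ => []

/-- `π = [π₁, …, π_{k-1}]` is a special palindromic factorization of `w`: one has
`w = a₁ π₁ a₂ π₂ ⋯ π_{k-1} a_k`, where `a₁ < ⋯ < a_k` are the letters that occur in `w`,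
and every `π_i` is a palindrome. -/
structure IsSpecialPalindromicFactorization {α : Type*} [LinearOrder α]
    (w : List α) (π : List (List α)) : Prop where
  length_eq : π.length + 1 = (letters w).length
  eq_interleave : w = interleave (letters w) π
  palindrome : ∀ p ∈ π, p.Palindrome

end ClusteringWord

/-! Let `r₀ < r₁ < ⋯` be the rows of the Burrows–Wheeler matrix of a perfectly clustering word of
length `n`, let `f i` be the first letter of `rᵢ`, and let `T i` be the index of the row obtained
from `rᵢ` by moving its first letter to the end. Rows with the same first letter keep their order
under `T`, and the last column is the decreasing rearrangement of the first one. So `T` is a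
symmetric interval exchange: it is a translation on each block `f = a`, and it reverses the order
of the blocks (`IsPerfectlyClustering.exists_exchange`). The row `rᵢ` is the coding
`f i, f (T i), f (T² i), …` of the orbit of `i`. Moreover `T = σ ρ`, where `σ` is the reflection of
the whole interval and `ρ` reflects each block, so reading a coding backwards gives the coding of a
reflected point (`Exchange.reverse_word`).

Call `e` a boundary if `f e ≠ f (e + 1)`. The pairs of neighbours `i`, `i + 1` are moved by `T` as
long as they stay inside a block, which decomposes them into paths, each of which starts at the
reflection `σ` of a boundary and ends at a boundary. The crucial fact is that the path starting at
the reflection of `e` ends at `e` itself (`Exchange.IsCyclic.exists_path`). This is a count of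
fixed points. If boundaries are regarded as fixed by `ρ`, then `σ` and `ρ` act on points and pairs
together. A cycle of a product of two involutions contains at most two fixed points of the
involutions (`reflection_fix_trichotomy`). Besides the `k - 1` boundaries there are `k + 1` fixed
points, namely the centres of the `k` blocks and of the interval. At most two of these are points,
all points being on one cycle, and each of the others is on the cycle of a boundary. So each
boundary shares its cycle with exactly one centre and with no other boundary
(`Exchange.IsCyclic.boundary_unique`).

Consequently `σ` exchanges the ends of each path, the word read along a path is a palindrome, and
the rows of two neighbours are `y m x` and `y m̃ x` with `x y` the palindrome of their path
(`Exchange.IsCyclic.exists_word_eq`). From the first point of a block, `T` leads to the start of the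
path of the boundary that ends the block, and the path leads to the first point of the next block.
Therefore `r₀`, which is the Lyndon conjugate, is `a₁ π₁ a₂ ⋯ π_{k-1} a_k` with `πᵢ` the palindromes
of the paths. In any other factorization of this kind, a palindrome between the blocks of `aᵢ` and
`aᵢ₊₁` is a common prefix of the codings of two points between which the path of `πᵢ` starts,
so it is at most as long as `πᵢ`; as the total lengths agree, so do the factorizations
(`Exchange.IsCyclic.exists_factorization`). -/

namespace ClusteringWord

/-! ### Products of two involutions -/

/-- The reflections of the dihedral group generated by two involutions: `σ` for `true`,
`ρ` for `false`. -/
def reflection {Y : Type*} (σ ρ : Equiv.Perm Y) (b : Bool) : Equiv.Perm Y :=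
  cond b σ ρ

/-- A fixed point of `g ^ b * ρ` (with `g = σ * ρ`) that lies at distance `m` from a fixed point of
`g ^ a * ρ` forces `g ^ (2 * m + a - b)` to fix the latter. -/
theorem zpow_fix_of_reflection_fix {Y : Type*} {σ ρ : Equiv.Perm Y} (hσ : σ * σ = 1)
    (hρ : ρ * ρ = 1) {a b : Bool} {x y : Y} {m : ℤ} (hx : reflection σ ρ a x = x)
    (hy : reflection σ ρ b y = y) (hm : ((σ * ρ) ^ m) x = y) :
    ((σ * ρ) ^ (2 * m + (a.toNat : ℤ) - b.toNat)) x = x := by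
  have hρi : ρ⁻¹ = ρ := inv_eq_of_mul_eq_one_left hρ
  have hσi : σ⁻¹ = σ := inv_eq_of_mul_eq_one_left hσ
  have hconj : ∀ m : ℤ, ρ * (σ * ρ) ^ m = (σ * ρ) ^ (-m) * ρ := by
    intro m
    have h1 : ρ * (σ * ρ) * ρ⁻¹ = (σ * ρ)⁻¹ := by
      rw [mul_inv_rev, hρi, hσi, mul_assoc, mul_assoc, hρ, mul_one]
    have h2 : ρ * (σ * ρ) ^ m * ρ⁻¹ = (σ * ρ) ^ (-m) := by
      rw [← conj_zpow, h1, inv_zpow, zpow_neg]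
    rw [← h2, inv_mul_cancel_right]
  have hrefl : ∀ c : Bool, reflection σ ρ c = (σ * ρ) ^ (c.toNat : ℤ) * ρ := by
    intro c
    cases c
    · simp [reflection]
    · simp [reflection, mul_assoc, hρ]
  have hρx : ρ x = ((σ * ρ) ^ (-(a.toNat : ℤ))) x := by
    rw [hrefl] at hx
    rw [zpow_neg, Equiv.Perm.eq_inv_iff_eq]
    exact hx
  have h3 : ((σ * ρ) ^ ((b.toNat : ℤ) + -m + -(a.toNat : ℤ))) x = ((σ * ρ) ^ m) x := by
    rw [zpow_add, Equiv.Perm.mul_apply, ← hρx, zpow_add, Equiv.Perm.mul_apply,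
      ← Equiv.Perm.mul_apply _ ρ, ← hconj, Equiv.Perm.mul_apply, hm,
      ← Equiv.Perm.mul_apply, ← hrefl, hy]
  have h4 : (2 * m + (a.toNat : ℤ) - b.toNat) = -((b.toNat : ℤ) + -m + -(a.toNat : ℤ)) + m := by
    ring
  rw [h4, zpow_add, Equiv.Perm.mul_apply, ← h3, zpow_neg, Equiv.Perm.inv_eq_iff_eq]

/-- A cycle of the product of two involutions `σ`, `ρ` contains at most two fixed points of
`σ` or `ρ`, where a common fixed point counts twice. -/
theorem reflection_fix_trichotomy {Y : Type*} {σ ρ : Equiv.Perm Y} (hσ : σ * σ = 1)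
    (hρ : ρ * ρ = 1) {p₁ p₂ p₃ : Bool × Y} (h₁ : reflection σ ρ p₁.1 p₁.2 = p₁.2)
    (h₂ : reflection σ ρ p₂.1 p₂.2 = p₂.2) (h₃ : reflection σ ρ p₃.1 p₃.2 = p₃.2)
    (h₁₂ : (σ * ρ).SameCycle p₁.2 p₂.2) (h₁₃ : (σ * ρ).SameCycle p₁.2 p₃.2) :
    p₁ = p₂ ∨ p₁ = p₃ ∨ p₂ = p₃ := by
  obtain ⟨a, x⟩ := p₁
  obtain ⟨b, y⟩ := p₂
  obtain ⟨c, z⟩ := p₃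
  obtain ⟨m, hm⟩ := h₁₂
  obtain ⟨l, hl⟩ := h₁₃
  dsimp only at *
  have hper : ∀ u : ℤ, ((σ * ρ) ^ u) x = x ↔ (Function.minimalPeriod (σ * ρ) x : ℤ) ∣ u := by
    intro u
    exact MulAction.zpow_smul_eq_iff_minimalPeriod_dvd (a := σ * ρ) (b := x) (n := u)
  -- `2 * m + a - b` and `2 * l + a - c` are multiples of the period `N`; modulo `2 * N`
  -- each is `0`, which means coincidence with the first fixed point, or `N`, and two fixed points
  -- with the residue `N` coincide
  obtain ⟨u, hu⟩ := (hper _).1 (zpow_fix_of_reflection_fix hσ hρ h₁ h₂ hm)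
  obtain ⟨v, hv⟩ := (hper _).1 (zpow_fix_of_reflection_fix hσ hρ h₁ h₃ hl)
  set N : ℤ := (Function.minimalPeriod (σ * ρ) x : ℤ)
  have key : ∀ {d e : Bool} {i j k : ℤ}, 2 * (i - j) + (d.toNat : ℤ) - e.toNat = N * (2 * k) →
      d = e ∧ ((σ * ρ) ^ i) x = ((σ * ρ) ^ j) x := by
    intro d e i j k h
    have hde : d = e := by
      rw [mul_left_comm] at h
      cases d <;> cases e <;> simp at h ⊢ <;> omega
    refine ⟨hde, ?_⟩
    subst hde
    have h5 : i - j = N * k := by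
      rw [mul_left_comm] at h
      linarith
    have h6 : i = j + (i - j) := by ring
    rw [h6, zpow_add, Equiv.Perm.mul_apply, (hper _).2 ⟨k, h5⟩]
  rcases Int.even_or_odd' u with ⟨u', hu' | hu'⟩
  · left
    obtain ⟨h, h'⟩ := key (d := a) (e := b) (i := m) (j := 0) (k := u') (by rw [← hu', ← hu]; ring)
    rw [hm] at h'
    simp [h, h']
  rcases Int.even_or_odd' v with ⟨v', hv' | hv'⟩
  · right; left
    obtain ⟨h, h'⟩ := key (d := a) (e := c) (i := l) (j := 0) (k := v') (by rw [← hv', ← hv]; ring)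
    rw [hl] at h'
    simp [h, h']
  · right; right
    obtain ⟨h, h'⟩ := key (d := c) (e := b) (i := m) (j := l) (k := u' - v') (by
      have : N * (2 * (u' - v')) = N * u - N * v := by rw [hu', hv']; ring
      rw [this, ← hu, ← hv]; ring)
    rw [hm, hl] at h'
    simp [h, h']

/-! ### Discrete symmetric interval exchanges -/

/-- The set `{0, …, n - 1}`, realized inside `ℤ`, coded by a weakly increasing map `f` to an
alphabet. The block of `i`, that is, the set of points with the same letter as `i`, is the interval
from `lo i` to `hi i`. Values outside of `{0, …, n - 1}` carry no information. -/
structure Exchange (α : Type*) [LinearOrder α] where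
  n : ℕ
  f : ℤ → α
  lo : ℤ → ℤ
  hi : ℤ → ℤ
  mono : ∀ {i j : ℤ}, 0 ≤ i → i ≤ j → j < n → f i ≤ f j
  lo_nonneg : ∀ {i : ℤ}, 0 ≤ i → i < n → 0 ≤ lo i
  hi_lt : ∀ {i : ℤ}, 0 ≤ i → i < n → hi i < n
  eq_iff : ∀ {i j : ℤ}, 0 ≤ i → i < n → 0 ≤ j → j < n → (f j = f i ↔ lo i ≤ j ∧ j ≤ hi i)

namespace Exchange

variable {α : Type*} [LinearOrder α] (E : Exchange α)

/-- The map that exchanges the blocks: it is a translation on each block, and the images of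
the blocks appear in reverse order. -/
def T (i : ℤ) : ℤ := E.n - 1 - E.lo i - E.hi i + i

/-- The word of length `t` that codes the first `t` points of the orbit of `i`. -/
def word : ℤ → ℕ → List α
  | _, 0 => []
  | i, t + 1 => E.f i :: word (E.T i) t

/-- The exchange is a single cycle, and its points are told apart by their codings. -/
structure IsCyclic : Prop where
  iterate_n : ∀ {i : ℤ}, 0 ≤ i → i < E.n → E.T^[E.n] i = i
  exists_iterate : ∀ {i : ℤ}, 0 ≤ i → i < E.n → ∃ t < E.n, E.T^[t] 0 = i
  word_inj : ∀ {i j : ℤ}, 0 ≤ i → i < E.n → 0 ≤ j → j < E.n → E.word i E.n = E.word j E.n → i = j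

/-- `e` is the last point of its block and `e + 1` the first point of the next one. -/
structure IsBoundary (e : ℤ) : Prop where
  nonneg : 0 ≤ e
  lt : e + 1 < E.n
  ne : E.f e ≠ E.f (e + 1)

variable {E} {i j : ℤ}

theorem lo_le (hi₀ : 0 ≤ i) (hin : i < E.n) : E.lo i ≤ i :=
  ((E.eq_iff hi₀ hin hi₀ hin).1 rfl).1

theorem le_hi (hi₀ : 0 ≤ i) (hin : i < E.n) : i ≤ E.hi i :=
  ((E.eq_iff hi₀ hin hi₀ hin).1 rfl).2

theorem lo_hi_congr (hi₀ : 0 ≤ i) (hin : i < E.n) (hj₀ : 0 ≤ j) (hjn : j < E.n)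
    (h : E.f i = E.f j) : E.lo i = E.lo j ∧ E.hi i = E.hi j := by
  have aux : ∀ {i j : ℤ}, 0 ≤ i → i < E.n → 0 ≤ j → j < E.n → E.f i = E.f j →
      E.lo j ≤ E.lo i ∧ E.hi i ≤ E.hi j := by
    intro i j hi₀ hin hj₀ hjn h
    have h₁ := E.lo_nonneg hi₀ hin
    have h₂ := E.hi_lt hi₀ hin
    have h₃ := lo_le hi₀ hin
    have h₄ := le_hi hi₀ hin
    have h₅ : E.f (E.lo i) = E.f i :=
      (E.eq_iff hi₀ hin h₁ (by omega)).2 ⟨le_refl _, by omega⟩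
    have h₆ : E.f (E.hi i) = E.f i :=
      (E.eq_iff hi₀ hin (by omega) h₂).2 ⟨by omega, le_refl _⟩
    exact ⟨((E.eq_iff hj₀ hjn h₁ (by omega)).1 (h₅.trans h)).1,
      ((E.eq_iff hj₀ hjn (by omega) h₂).1 (h₆.trans h)).2⟩
  have h₁ := aux hi₀ hin hj₀ hjn h
  have h₂ := aux hj₀ hjn hi₀ hin h.symm
  omega

theorem T_nonneg (hi₀ : 0 ≤ i) (hin : i < E.n) : 0 ≤ E.T i := by
  have h₁ := E.lo_nonneg hi₀ hin
  have h₂ := E.hi_lt hi₀ hin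
  have h₃ := lo_le hi₀ hin
  have h₄ := le_hi hi₀ hin
  unfold T
  omega

theorem T_lt (hi₀ : 0 ≤ i) (hin : i < E.n) : E.T i < E.n := by
  have h₁ := E.lo_nonneg hi₀ hin
  have h₂ := E.hi_lt hi₀ hin
  have h₃ := lo_le hi₀ hin
  have h₄ := le_hi hi₀ hin
  unfold T
  omega

theorem T_sub (hi₀ : 0 ≤ i) (hin : i < E.n) (hj₀ : 0 ≤ j) (hjn : j < E.n)
    (h : E.f i = E.f j) : E.T j - E.T i = j - i := by
  obtain ⟨h₁, h₂⟩ := lo_hi_congr hi₀ hin hj₀ hjn h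
  unfold T
  omega

/-- Reflecting the image of `i` gives the reflection of `i` inside its block. -/
theorem f_reflect_T (hi₀ : 0 ≤ i) (hin : i < E.n) : E.f (E.n - 1 - E.T i) = E.f i := by
  have h₁ := E.lo_nonneg hi₀ hin
  have h₂ := E.hi_lt hi₀ hin
  have h₃ := lo_le hi₀ hin
  have h₄ := le_hi hi₀ hin
  refine (E.eq_iff hi₀ hin ?_ ?_).2 ⟨?_, ?_⟩ <;> unfold T <;> omega

/-- The reflection of the whole interval conjugates `T` to its inverse. -/
theorem T_reflect_T (hi₀ : 0 ≤ i) (hin : i < E.n) :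
    E.T (E.n - 1 - E.T i) = E.n - 1 - i := by
  have h₁ := T_nonneg hi₀ hin
  have h₂ := T_lt hi₀ hin
  have h₃ := lo_hi_congr (by omega) (by omega) hi₀ hin (f_reflect_T hi₀ hin)
  have h₄ : E.T i = E.n - 1 - E.lo i - E.hi i + i := rfl
  have h₅ : E.T (E.n - 1 - E.T i) = E.n - 1 - E.lo (E.n - 1 - E.T i) - E.hi (E.n - 1 - E.T i)
    + (E.n - 1 - E.T i) := rfl
  omega

theorem iterate_mem (hi₀ : 0 ≤ i) (hin : i < E.n) (t : ℕ) :
    0 ≤ E.T^[t] i ∧ E.T^[t] i < E.n := by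
  induction t generalizing i with
  | zero => exact ⟨hi₀, hin⟩
  | succ t ih => exact ih (T_nonneg hi₀ hin) (T_lt hi₀ hin)

theorem iterate_reflect_iterate (hi₀ : 0 ≤ i) (hin : i < E.n) (t : ℕ) :
    E.T^[t] (E.n - 1 - E.T^[t] i) = E.n - 1 - i := by
  induction t generalizing i with
  | zero => rfl
  | succ t ih =>
    rw [Function.iterate_succ_apply', Function.iterate_succ_apply,
      ih (T_nonneg hi₀ hin) (T_lt hi₀ hin), T_reflect_T hi₀ hin]

/-! ### Codings of orbits -/

@[simp]
theorem length_word (i : ℤ) (t : ℕ) : (E.word i t).length = t := by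
  induction t generalizing i with
  | zero => rfl
  | succ t ih => simp [word, ih]

theorem word_add (i : ℤ) (s t : ℕ) :
    E.word i (s + t) = E.word i s ++ E.word (E.T^[s] i) t := by
  induction s generalizing i with
  | zero => simp [word]
  | succ s ih =>
    rw [add_right_comm]
    simp [word, ih]

theorem word_succ' (i : ℤ) (t : ℕ) :
    E.word i (t + 1) = E.word i t ++ [E.f (E.T^[t] i)] := by
  rw [word_add]
  rfl

/-- Reading an orbit segment backwards amounts to reading the orbit of the reflected endpoint. -/
theorem reverse_word (hi₀ : 0 ≤ i) (hin : i < E.n) (t : ℕ) :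
    (E.word i t).reverse = E.word (E.n - 1 - E.T^[t] i) t := by
  induction t generalizing i with
  | zero => rfl
  | succ t ih =>
    have h₁ := T_nonneg hi₀ hin
    have h₂ := T_lt hi₀ hin
    rw [word_succ' (_ - _), word, List.reverse_cons, ih h₁ h₂, Function.iterate_succ_apply,
      iterate_reflect_iterate h₁ h₂, f_reflect_T hi₀ hin]

theorem word_eq_iff (i j : ℤ) (t : ℕ) :
    E.word i t = E.word j t ↔ ∀ s < t, E.f (E.T^[s] i) = E.f (E.T^[s] j) := by
  induction t generalizing i j with
  | zero => simp [word]
  | succ t ih =>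
    simp only [word, List.cons.injEq, ih]
    constructor
    · rintro ⟨h₁, h₂⟩ (_ | s) hs
      · exact h₁
      · exact h₂ s (by omega)
    · intro h
      exact ⟨h 0 (by omega), fun s hs => h (s + 1) (by omega)⟩

/-- Points with the same coding of length `t` are translated by the same amounts for `t` steps. -/
theorem iterate_sub (hi₀ : 0 ≤ i) (hin : i < E.n) (hj₀ : 0 ≤ j) (hjn : j < E.n) {t : ℕ}
    (h : E.word i t = E.word j t) : E.T^[t] j - E.T^[t] i = j - i := by
  induction t generalizing i j with
  | zero => rfl
  | succ t ih =>
    simp only [word, List.cons.injEq] at h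
    rw [Function.iterate_succ_apply, Function.iterate_succ_apply,
      ih (T_nonneg hi₀ hin) (T_lt hi₀ hin) (T_nonneg hj₀ hjn) (T_lt hj₀ hjn) h.2,
      T_sub hi₀ hin hj₀ hjn h.1]

/-- The points with a given coding of length `t` form an interval. -/
theorem word_eq_of_between {k : ℤ} (hi₀ : 0 ≤ i) (hij : i ≤ j) (hjk : j ≤ k) (hkn : k < E.n)
    {t : ℕ} (h : E.word i t = E.word k t) : E.word j t = E.word k t := by
  induction t generalizing i j k with
  | zero => rfl
  | succ t ih =>
    simp only [word, List.cons.injEq] at h ⊢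
    have hf : E.f j = E.f k :=
      le_antisymm (E.mono (by omega) hjk hkn) (h.1 ▸ E.mono hi₀ hij (by omega))
    refine ⟨hf, ih (T_nonneg hi₀ (by omega)) ?_ ?_ (T_lt (by omega) hkn) h.2⟩
    · have := T_sub hi₀ (by omega) (by omega) (by omega) (h.1.trans hf.symm)
      omega
    · have := T_sub (by omega) (by omega) (by omega) hkn hf
      omega

theorem word_take (i : ℤ) {s t : ℕ} (h : s ≤ t) : (E.word i t).take s = E.word i s := by
  obtain ⟨u, rfl⟩ := Nat.exists_eq_add_of_le h
  rw [word_add, List.take_left' (by simp)]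

theorem word_eq_of_le {s t : ℕ} (h : s ≤ t) (hw : E.word i t = E.word j t) :
    E.word i s = E.word j s := by
  rw [← word_take i h, ← word_take j h, hw]

/-! ### The doubled interval -/

/-- The reflection of the whole interval, in coordinates where the point `i` is `2 * i` and the
pair of neighbours `i`, `i + 1` is `2 * i + 1`. -/
def sigma (E : Exchange α) : Equiv.Perm ℤ :=
  Function.Involutive.toPerm (fun q => 2 * E.n - 2 - q) (fun q => by ring)

variable (E) in
/-- `q` is, in doubled coordinates, a point or a pair of neighbours inside one block. -/
def InBlock (q : ℤ) : Prop :=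
  0 ≤ q ∧ q ≤ 2 * E.n - 2 ∧ E.f (q / 2) = E.f ((q + 1) / 2)

open Classical in
variable (E) in
/-- The reflection inside the blocks in doubled coordinates; it fixes the pairs of neighbours that
belong to different blocks. -/
noncomputable def rhoFun (q : ℤ) : ℤ :=
  if E.InBlock q then 2 * (E.lo (q / 2) + E.hi (q / 2)) - q else q

theorem rhoFun_of_inBlock {q : ℤ} (h : E.InBlock q) :
    E.rhoFun q = 2 * (E.lo (q / 2) + E.hi (q / 2)) - q := if_pos h

theorem rhoFun_involutive : Function.Involutive E.rhoFun := by
  intro q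
  by_cases h : E.InBlock q
  · obtain ⟨h₀, hn, hf⟩ := id h
    have hi₀ : 0 ≤ q / 2 := by omega
    have hin : q / 2 < E.n := by omega
    have hj := (E.eq_iff hi₀ hin (j := (q + 1) / 2) (by omega) (by omega)).1 hf.symm
    have h₁ := E.lo_nonneg hi₀ hin
    have h₂ := E.hi_lt hi₀ hin
    have h₃ := lo_le hi₀ hin
    have h₄ := le_hi hi₀ hin
    have hq := rhoFun_of_inBlock h
    set r := E.rhoFun q
    have hr₁ : E.f (r / 2) = E.f (q / 2) :=
      (E.eq_iff hi₀ hin (by omega) (by omega)).2 (by omega)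
    have hr₂ : E.f ((r + 1) / 2) = E.f (q / 2) :=
      (E.eq_iff hi₀ hin (by omega) (by omega)).2 (by omega)
    have hr := lo_hi_congr (by omega) (by omega) hi₀ hin hr₁
    rw [rhoFun_of_inBlock ⟨by omega, by omega, hr₁.trans hr₂.symm⟩]
    omega
  · have hq : E.rhoFun q = q := if_neg h
    rw [hq, hq]

/-- The involution `rhoFun` as a permutation. -/
noncomputable def rho (E : Exchange α) : Equiv.Perm ℤ := rhoFun_involutive.toPerm E.rhoFun

theorem sigma_apply (q : ℤ) : E.sigma q = 2 * E.n - 2 - q := rfl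

theorem rho_of_inBlock {q : ℤ} (h : E.InBlock q) :
    E.rho q = 2 * (E.lo (q / 2) + E.hi (q / 2)) - q := rhoFun_of_inBlock h

theorem rho_of_not_inBlock {q : ℤ} (h : ¬ E.InBlock q) : E.rho q = q := if_neg h

theorem sigma_mul_self : E.sigma * E.sigma = 1 :=
  Equiv.ext fun q => by simp [sigma_apply]

theorem rho_mul_self : E.rho * E.rho = 1 :=
  Equiv.ext fun q => rhoFun_involutive q

/-- The product of the two reflections: it lifts `T` to the points and to the pairs inside
blocks. -/
noncomputable def lift (E : Exchange α) : Equiv.Perm ℤ := E.sigma * E.rho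

theorem lift_of_inBlock {q : ℤ} (h : E.InBlock q) : E.lift q = 2 * E.T (q / 2) + q % 2 := by
  rw [lift, Equiv.Perm.mul_apply, sigma_apply, rho_of_inBlock h, T]
  omega

theorem IsBoundary.not_inBlock {e : ℤ} (h : E.IsBoundary e) : ¬ E.InBlock (2 * e + 1) := by
  rintro ⟨-, -, hf⟩
  have h₁ : (2 * e + 1) / 2 = e := by omega
  have h₂ : (2 * e + 1 + 1) / 2 = e + 1 := by omega
  rw [h₁, h₂] at hf
  exact h.ne hf

theorem IsBoundary.lo_succ {e : ℤ} (h : E.IsBoundary e) : E.lo (e + 1) = e + 1 := by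
  have h₁ := h.nonneg
  have h₂ := h.lt
  have h₄ := lo_le (E := E) (i := e + 1) (by omega) h₂
  have h₅ := le_hi (E := E) (i := e + 1) (by omega) h₂
  have h₆ := mt (E.eq_iff (i := e + 1) (j := e) (by omega) h₂ h₁ (by omega)).2 h.ne
  omega

theorem lift_boundary {e : ℤ} (h : E.IsBoundary e) :
    E.lift (2 * e + 1) = 2 * (E.n - 2 - e) + 1 := by
  rw [lift, Equiv.Perm.mul_apply, sigma_apply, rho_of_not_inBlock h.not_inBlock]
  ring

theorem lift_pow_point (hi₀ : 0 ≤ i) (hin : i < E.n) (t : ℕ) :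
    (E.lift ^ t) (2 * i) = 2 * E.T^[t] i := by
  induction t generalizing i with
  | zero => rfl
  | succ t ih =>
    have h : E.InBlock (2 * i) := by
      refine ⟨by omega, by omega, ?_⟩
      congr 1
      omega
    have h₁ : E.lift (2 * i) = 2 * E.T i := by
      rw [lift_of_inBlock h]
      have : 2 * i / 2 = i := by omega
      rw [this]
      omega
    rw [pow_succ, Equiv.Perm.mul_apply, h₁, ih (T_nonneg hi₀ hin) (T_lt hi₀ hin),
      Function.iterate_succ_apply]

theorem lift_pow_pair (hi₀ : 0 ≤ i) (hin : i + 1 < E.n) {t : ℕ}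
    (h : E.word i t = E.word (i + 1) t) :
    (E.lift ^ t) (2 * i + 1) = 2 * E.T^[t] i + 1 := by
  induction t generalizing i with
  | zero => rfl
  | succ t ih =>
    simp only [word, List.cons.injEq] at h
    have h₁ : (2 * i + 1) / 2 = i := by omega
    have h₂ : (2 * i + 1 + 1) / 2 = i + 1 := by omega
    have hb : E.InBlock (2 * i + 1) := by
      refine ⟨by omega, by omega, ?_⟩
      rw [h₁, h₂]
      exact h.1
    have hT := T_sub hi₀ (by omega) (by omega) hin h.1
    have hT' : E.T (i + 1) = E.T i + 1 := by omega
    have hlt := T_lt (E := E) (i := i + 1) (by omega) hin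
    have h₃ : E.lift (2 * i + 1) = 2 * E.T i + 1 := by
      rw [lift_of_inBlock hb, h₁]
      omega
    rw [pow_succ, Equiv.Perm.mul_apply, h₃, Function.iterate_succ_apply]
    exact ih (T_nonneg hi₀ (by omega)) (by omega) (hT' ▸ h.2)

/-! ### Boundaries lie on distinct cycles -/

/-- Each pair of neighbours runs through pairs inside blocks until it reaches a boundary. -/
theorem IsCyclic.exists_boundary (hE : E.IsCyclic) (hi₀ : 0 ≤ i) (hin : i + 1 < E.n) :
    ∃ p < E.n, E.word i p = E.word (i + 1) p ∧ E.IsBoundary (E.T^[p] i) := by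
  classical
  have hex : ∃ p, E.word i (p + 1) ≠ E.word (i + 1) (p + 1) := by
    refine ⟨E.n - 1, fun h => ?_⟩
    have hn : E.n - 1 + 1 = E.n := by omega
    rw [hn] at h
    have := hE.word_inj hi₀ (by omega) (by omega) hin h
    omega
  have hp := Nat.find_spec hex
  have hmin := fun m => Nat.find_min hex (m := m)
  set p := Nat.find hex
  have hw : E.word i p = E.word (i + 1) p := by
    rcases Nat.eq_zero_or_pos p with h | h
    · rw [h]; rfl
    · have := hmin (p - 1) (by omega)
      rw [not_not] at this
      have hp' : p - 1 + 1 = p := by omega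
      rwa [hp'] at this
  have hT := iterate_sub hi₀ (by omega) (by omega) hin hw
  have hT' : E.T^[p] (i + 1) = E.T^[p] i + 1 := by omega
  have hm₁ := iterate_mem (E := E) hi₀ (by omega) p
  have hm₂ := iterate_mem (E := E) (i := i + 1) (by omega) hin p
  refine ⟨p, ?_, hw, hm₁.1, by omega, fun hf => hp ?_⟩
  · by_contra hpn
    have := hE.word_inj hi₀ (by omega) (by omega) hin (word_eq_of_le (not_lt.1 hpn) hw)
    omega
  · rw [word_succ', word_succ', hw, hT', hf]

/-- Distinct boundaries lie on distinct cycles of `lift`. The fixed points of the two reflections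
other than boundaries are the centre of the interval and the centres of the blocks, two more than
there are boundaries. At most two of them are points, since the points form one cycle; each of the
others is on the cycle of a boundary, and a cycle has room for two fixed points only. So
the boundaries are matched with these centres, and no cycle contains two boundaries. -/
theorem IsCyclic.boundary_unique (hE : E.IsCyclic) {e e' : ℤ} (he : E.IsBoundary e)
    (he' : E.IsBoundary e') (h : E.lift.SameCycle (2 * e + 1) (2 * e' + 1)) : e = e' := by
  classical
  have hn : 0 < (E.n : ℤ) := by have := he.nonneg; have := he.lt; omega
  let S : Finset ℤ := (Finset.Ico (0 : ℤ) E.n).filter fun i => E.lo i = i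
  let B : Finset ℤ := (Finset.Ico (0 : ℤ) E.n).filter fun i => E.IsBoundary i
  let C : Finset (Bool × ℤ) := insert (true, (E.n : ℤ) - 1) (S.image fun i => (false, i + E.hi i))
  have memS : ∀ {i}, i ∈ S ↔ (0 ≤ i ∧ i < E.n) ∧ E.lo i = i := by simp [S]
  have memB : ∀ {i}, i ∈ B ↔ E.IsBoundary i := by
    intro i
    simp only [B, Finset.mem_filter, Finset.mem_Ico, and_iff_right_iff_imp]
    intro h
    have := h.nonneg
    have := h.lt
    omega
  -- the first points of the blocks are `0` and the successors of the boundaries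
  have hSB : B.card + 1 ≤ S.card := by
    have h0 : insert 0 (B.image (· + 1)) ⊆ S := by
      intro i hi
      rw [Finset.mem_insert, Finset.mem_image] at hi
      rcases hi with rfl | ⟨e, heB, rfl⟩
      · have h₁ := E.lo_nonneg (le_refl 0) hn
        have h₂ := lo_le (le_refl 0) hn
        exact memS.2 ⟨⟨le_refl 0, hn⟩, by omega⟩
      · obtain ⟨h₁, h₂, h₃⟩ := memB.1 heB
        exact memS.2 ⟨⟨by omega, h₂⟩, (memB.1 heB).lo_succ⟩
    refine le_trans (le_of_eq ?_) (Finset.card_le_card h0)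
    rw [Finset.card_insert_of_notMem, Finset.card_image_of_injective _ (add_left_injective 1)]
    intro h
    obtain ⟨e, heB, he0⟩ := Finset.mem_image.1 h
    have := (memB.1 heB).nonneg
    omega
  have hcard : B.card + 2 ≤ C.card := by
    have hlt : ∀ {i j}, i ∈ S → j ∈ S → i < j → E.hi i < j := by
      intro i j hi hj hij
      obtain ⟨⟨hi₀, hin⟩, hi'⟩ := memS.1 hi
      obtain ⟨⟨hj₀, hjn⟩, hj'⟩ := memS.1 hj
      by_contra hle
      have h₁ := (E.eq_iff hi₀ hin hj₀ hjn).2 ⟨by omega, by omega⟩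
      have h₂ := lo_hi_congr hj₀ hjn hi₀ hin h₁
      omega
    have hinj : Set.InjOn (fun i => ((false, i + E.hi i) : Bool × ℤ)) S := by
      intro i hi j hj hij
      have hi' := (memS.1 hi).1
      have hj' := (memS.1 hj).1
      have h₁ := le_hi hi'.1 hi'.2
      have h₂ := le_hi hj'.1 hj'.2
      have h₃ : i + E.hi i = j + E.hi j := congrArg Prod.snd hij
      rcases lt_trichotomy i j with h | h | h
      · have := hlt hi hj h
        omega
      · exact h
      · have := hlt hj hi h
        omega
    rw [Finset.card_insert_of_notMem (by simp), Finset.card_image_of_injOn hinj]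
    omega
  -- the centres are fixed by their reflections, and they are not boundaries
  have hC : ∀ c ∈ C, (reflection E.sigma E.rho c.1 c.2 = c.2) ∧ 0 ≤ c.2 ∧ c.2 ≤ 2 * E.n - 2 ∧
      ∀ b, E.IsBoundary b → c ≠ (false, 2 * b + 1) := by
    intro c hc
    rw [Finset.mem_insert, Finset.mem_image] at hc
    rcases hc with rfl | ⟨i, hi, rfl⟩
    · refine ⟨?_, by dsimp only; omega, by dsimp only; omega, by simp⟩
      simp only [reflection, cond_true, sigma_apply]
      omega
    · obtain ⟨⟨hi₀, hin⟩, hi'⟩ := memS.1 hi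
      have h₁ := le_hi hi₀ hin
      have h₂ := E.hi_lt hi₀ hin
      have h₃ : E.f ((i + E.hi i) / 2) = E.f i :=
        (E.eq_iff hi₀ hin (by omega) (by omega)).2 (by omega)
      have h₄ : E.f ((i + E.hi i + 1) / 2) = E.f i :=
        (E.eq_iff hi₀ hin (by omega) (by omega)).2 (by omega)
      have hb : E.InBlock (i + E.hi i) := ⟨by omega, by omega, h₃.trans h₄.symm⟩
      have h₅ := lo_hi_congr (by omega) (by omega) hi₀ hin h₃
      refine ⟨?_, by dsimp only; omega, by dsimp only; omega, ?_⟩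
      · simp only [reflection, cond_false, rho_of_inBlock hb]
        omega
      · intro b hbd hcb
        have h₆ : i + E.hi i = 2 * b + 1 := congrArg Prod.snd hcb
        exact hbd.not_inBlock (h₆ ▸ hb)
  -- three centres among the points, which form one cycle, would be too many
  have heven : (C.filter fun c => Even c.2).card ≤ 2 := by
    by_contra hlt
    obtain ⟨a, ha, b, hb, c, hc, hab, hac, hbc⟩ := Finset.two_lt_card.1 (not_le.1 hlt)
    have hpt : ∀ {c}, c ∈ C.filter (fun c => Even c.2) → E.lift.SameCycle (2 * 0) c.2 := by
      intro c hc
      obtain ⟨hc, x, hx⟩ := Finset.mem_filter.1 hc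
      obtain ⟨-, h₁, h₂, -⟩ := hC c hc
      obtain ⟨t, -, ht⟩ := hE.exists_iterate (i := x) (by omega) (by omega)
      refine ⟨t, ?_⟩
      rw [zpow_natCast, lift_pow_point (le_refl 0) hn, ht, hx]
      ring
    have htri := reflection_fix_trichotomy sigma_mul_self rho_mul_self
      (hC a (Finset.mem_filter.1 ha).1).1 (hC b (Finset.mem_filter.1 hb).1).1
      (hC c (Finset.mem_filter.1 hc).1).1 ((hpt ha).symm.trans (hpt hb))
      ((hpt ha).symm.trans (hpt hc))
    tauto
  have hodd : B.card ≤ (C.filter fun c => ¬ Even c.2).card := by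
    have := Finset.card_filter_add_card_filter_not (s := C) (fun c => Even c.2)
    omega
  have hex : ∀ c ∈ C.filter (fun c => ¬ Even c.2), ∃ b ∈ B, E.lift.SameCycle c.2 (2 * b + 1) := by
    intro c hc
    obtain ⟨hc, hco⟩ := Finset.mem_filter.1 hc
    obtain ⟨-, h₁, h₂, -⟩ := hC c hc
    obtain ⟨x, hx⟩ := Int.not_even_iff_odd.1 hco
    obtain ⟨p, -, hw, hb⟩ := hE.exists_boundary (i := x) (by omega) (by omega)
    refine ⟨_, memB.2 hb, p, ?_⟩
    rw [zpow_natCast, hx, lift_pow_pair (by omega) (by omega) hw]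
  choose! ψ hψB hψ using hex
  have htwo : ∀ c ∈ C.filter (fun c => ¬ Even c.2), ∀ c' ∈ C.filter (fun c => ¬ Even c.2), ∀ b,
      E.IsBoundary b → E.lift.SameCycle c.2 (2 * b + 1) → E.lift.SameCycle c'.2 (2 * b + 1) →
      c = c' := by
    intro c hc c' hc' b hb h₁ h₂
    obtain ⟨hf, -, -, hne⟩ := hC c (Finset.mem_filter.1 hc).1
    obtain ⟨hf', -, -, hne'⟩ := hC c' (Finset.mem_filter.1 hc').1
    have hbf : reflection E.sigma E.rho (false, 2 * b + 1).1 (false, 2 * b + 1).2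
        = (false, 2 * b + 1).2 := rho_of_not_inBlock hb.not_inBlock
    rcases reflection_fix_trichotomy sigma_mul_self rho_mul_self hbf hf hf' h₁.symm h₂.symm
      with h | h | h
    · exact absurd h.symm (hne b hb)
    · exact absurd h.symm (hne' b hb)
    · exact h
  have hsurj := Finset.surj_on_of_inj_on_of_card_le (fun c _ => ψ c) hψB
    (fun c c' hc hc' hcc => htwo c hc c' hc' (ψ c) (memB.1 (hψB c hc)) (hψ c hc)
      (by rw [hcc]; exact hψ c' hc')) hodd
  obtain ⟨c, hc, hce⟩ := hsurj e (memB.2 he)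
  obtain ⟨c', hc', hce'⟩ := hsurj e' (memB.2 he')
  have h₁ := hψ c hc
  have h₂ := hψ c' hc'
  rw [← hce] at h₁
  rw [← hce'] at h₂
  have := htwo c hc c' hc' e he h₁ (h₂.trans h.symm)
  rw [hce, hce', this]

variable (E) in
/-- The pair of neighbours at the reflection of the boundary `e` stays inside blocks for `N` steps
and then is at `e`. -/
structure IsPath (e : ℤ) (N : ℕ) : Prop where
  isBoundary : E.IsBoundary e
  lt : N < E.n
  word_eq : E.word (E.n - 2 - e) N = E.word (E.n - 2 - e + 1) N
  iterate : E.T^[N] (E.n - 2 - e) = e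

/-- The path that starts at the reflection of a boundary ends at the same boundary. -/
theorem IsCyclic.exists_path (hE : E.IsCyclic) {e : ℤ} (he : E.IsBoundary e) :
    ∃ N, E.IsPath e N := by
  have h₀ := he.nonneg
  have h₁ := he.lt
  obtain ⟨N, hN, hw, hb⟩ := hE.exists_boundary (i := E.n - 2 - e) (by omega) (by omega)
  refine ⟨N, he, hN, hw, (hE.boundary_unique he hb ⟨(N + 1 : ℕ), ?_⟩).symm⟩
  rw [zpow_natCast, pow_succ, Equiv.Perm.mul_apply, lift_boundary he,
    lift_pow_pair (by omega) (by omega) hw]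

/-- Each pair of neighbours lies on the path of some boundary. -/
theorem IsCyclic.exists_mem_path (hE : E.IsCyclic) (hi₀ : 0 ≤ i) (hin : i + 1 < E.n) :
    ∃ e N q, E.IsPath e N ∧ q ≤ N ∧ E.T^[q] (E.n - 2 - e) = i := by
  obtain ⟨p, -, hw, hb⟩ := hE.exists_boundary hi₀ hin
  obtain ⟨N, hN⟩ := hE.exists_path hb
  obtain ⟨-, -, hwN, hTN⟩ := id hN
  set e := E.T^[p] i with he
  have h₀ := hb.nonneg
  have h₁ := hb.lt
  have hp : (E.lift ^ p) (2 * i + 1) = 2 * e + 1 := lift_pow_pair hi₀ hin hw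
  have hs : (E.lift ^ N) (2 * (E.n - 2 - e) + 1) = 2 * e + 1 := by
    rw [lift_pow_pair (by omega) (by omega) hwN, hTN]
  have hpN : p ≤ N := by
    -- otherwise the pair would have met the boundary `e` before
    by_contra hlt
    obtain ⟨r, hr⟩ := Nat.exists_eq_add_of_lt (not_le.1 hlt)
    have h₂ : (E.lift ^ r) (2 * i + 1) = 2 * e + 1 := by
      apply (E.lift ^ (N + 1)).injective
      rw [← Equiv.Perm.mul_apply, ← pow_add, pow_succ E.lift N, Equiv.Perm.mul_apply,
        lift_boundary hb, hs, ← hp]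
      congr 2
      omega
    rw [lift_pow_pair hi₀ hin (word_eq_of_le (by omega) hw)] at h₂
    have h₃ := word_eq_of_le (s := r) (by omega) hw
    have h₄ := iterate_sub hi₀ (by omega) (by omega) hin h₃
    have h₅ := (word_eq_iff _ _ _).1 hw r (by omega)
    have h₆ : E.T^[r] i = e := by omega
    have h₇ : E.T^[r] (i + 1) = e + 1 := by omega
    rw [h₆, h₇] at h₅
    exact hb.ne h₅
  refine ⟨e, N, N - p, hN, by omega, ?_⟩
  have h₂ : (E.lift ^ (N - p)) (2 * (E.n - 2 - e) + 1) = 2 * i + 1 := by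
    apply (E.lift ^ p).injective
    rw [← Equiv.Perm.mul_apply, ← pow_add, hp, ← hs]
    congr 2
    omega
  rw [lift_pow_pair (by omega) (by omega) (word_eq_of_le (by omega) hwN)] at h₂
  omega

end Exchange

/-! ### Interleavings -/

theorem exists_interleave_eq_cons {α : Type*} (a : α) (as : List α) (πs : List (List α)) :
    ∃ l, interleave (a :: as) πs = a :: l := by
  cases πs <;> simp [interleave]

namespace Exchange

variable {α : Type*} [LinearOrder α] {E : Exchange α} {i j : ℤ}

/-! ### Palindromes along the paths -/

namespace IsPath

variable {e : ℤ} {N : ℕ}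

theorem iterate_succ (h : E.IsPath e N) : E.T^[N] (E.n - 2 - e + 1) = e + 1 := by
  have h₀ := h.isBoundary.nonneg
  have h₁ := h.isBoundary.lt
  have h₂ := iterate_sub (by omega) (by omega) (by omega) (by omega) h.word_eq
  have h₃ := h.iterate
  omega

/-- The length of a path is the exact length of the common coding of the two neighbours. -/
theorem le_of_word_eq (h : E.IsPath e N) {t : ℕ}
    (ht : E.word (E.n - 2 - e) t = E.word (E.n - 2 - e + 1) t) : t ≤ N := by
  by_contra hlt
  have h₁ := (word_eq_iff _ _ _).1 ht N (by omega)
  rw [h.iterate, h.iterate_succ] at h₁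
  exact h.isBoundary.ne h₁

theorem length_unique (h : E.IsPath e N) {N' : ℕ} (h' : E.IsPath e N') : N = N' :=
  le_antisymm (h'.le_of_word_eq h.word_eq) (h.le_of_word_eq h'.word_eq)

/-- The reflection of the interval exchanges the two ends of a path, so the word read along it
is a palindrome. -/
theorem palindrome (h : E.IsPath e N) : (E.word (E.n - 2 - e) N).Palindrome := by
  have h₀ := h.isBoundary.nonneg
  have h₁ := h.isBoundary.lt
  refine List.Palindrome.of_reverse_eq ?_
  rw [reverse_word (by omega) (by omega), h.iterate, h.word_eq]
  congr 1
  ring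

end IsPath

/-- Two neighbouring orbits read a factor of the palindrome of their path, then two words that are
mirror images of each other, then the rest of the palindrome. -/
theorem IsCyclic.exists_word_eq (hE : E.IsCyclic) (hi₀ : 0 ≤ i) (hin : i + 1 < E.n) :
    ∃ e N, E.IsPath e N ∧ ∃ x y m : List α, E.word i E.n = y ++ m ++ x ∧
      E.word (i + 1) E.n = y ++ m.reverse ++ x ∧ x ++ y = E.word (E.n - 2 - e) N := by
  obtain ⟨e, N, q, hN, hqN, hq⟩ := hE.exists_mem_path hi₀ hin
  have h₀ := hN.isBoundary.nonneg
  have h₁ := hN.isBoundary.lt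
  have hNn := hN.lt
  have hwq := word_eq_of_le hqN hN.word_eq
  have hq' : E.T^[q] (E.n - 2 - e + 1) = i + 1 := by
    have h₂ := iterate_sub (by omega) (by omega) (by omega) (by omega) hwq
    omega
  have hie : E.T^[N - q] i = e := by
    rw [← hq, ← Function.iterate_add_apply, Nat.sub_add_cancel hqN, hN.iterate]
  have hie' : E.T^[N - q] (i + 1) = e + 1 := by
    rw [← hq', ← Function.iterate_add_apply, Nat.sub_add_cancel hqN, hN.iterate_succ]
  have hes : E.T^[E.n - N] e = E.n - 2 - e := by
    have h₂ : E.T^[(E.n - N) + N] (E.n - 2 - e) = E.n - 2 - e := by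
      rw [Nat.sub_add_cancel hNn.le, hE.iterate_n (by omega) (by omega)]
    rwa [Function.iterate_add_apply, hN.iterate] at h₂
  have hes' : E.T^[E.n - N] (e + 1) = E.n - 2 - e + 1 := by
    have h₂ : E.T^[(E.n - N) + N] (E.n - 2 - e + 1) = E.n - 2 - e + 1 := by
      rw [Nat.sub_add_cancel hNn.le, hE.iterate_n (by omega) (by omega)]
    rwa [Function.iterate_add_apply, hN.iterate_succ] at h₂
  have hn : E.n = (N - q) + ((E.n - N) + q) := by omega
  have hwi : ∀ i, E.word i E.n = E.word i (N - q) ++ E.word (E.T^[N - q] i) (E.n - N) ++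
      E.word (E.T^[E.n - N] (E.T^[N - q] i)) q := by
    intro i
    rw [List.append_assoc, ← word_add, ← word_add, ← hn]
  have hNq : N = q + (N - q) := by omega
  have hs : ∀ j, E.word j N = E.word j q ++ E.word (E.T^[q] j) (N - q) := by
    intro j
    rw [← word_add, ← hNq]
  refine ⟨e, N, hN, E.word (E.n - 2 - e) q, E.word i (N - q), E.word e (E.n - N), ?_, ?_, ?_⟩
  · rw [hwi, hie, hes]
  · have hrev : (E.word e (E.n - N)).reverse = E.word (e + 1) (E.n - N) := by
      rw [reverse_word h₀ (by omega), hes]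
      congr 1
      ring
    have hy : E.word i (N - q) = E.word (i + 1) (N - q) := by
      have h₂ := hN.word_eq
      rw [hs, hs (_ + 1), hq, hq'] at h₂
      exact (List.append_inj h₂ (by simp)).2
    rw [hwi, hie', hes', hrev, hwq, hy]
  · rw [hs, hq]

/-! ### The factorization -/

/-- Starting at the first point `F` of a block, the orbit follows the paths of the boundaries
after `F` in increasing order and then arrives at `0`; the word read on the way is the special
factorization. Every factorization of the same kind read from the block of `F` is at most as long,
since a palindrome between two blocks cannot be longer than the path between them; it is the same
if its length is the same. -/
theorem IsCyclic.exists_factorization (hE : E.IsCyclic) (as : List α) :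
    ∀ F : ℤ, 0 ≤ F → F < E.n → E.lo F = F → as.Pairwise (· < ·) →
    (∀ a, a ∈ as ↔ ∃ i, F ≤ i ∧ i < E.n ∧ E.f i = a) →
    ∃ (πs : List (List α)) (M : ℕ), 0 < M ∧ E.T^[M] F = 0 ∧
      (∀ t, 0 < t → t < M → 0 < E.T^[t] F) ∧
      E.word F M = interleave as πs ∧ πs.length + 1 = as.length ∧ (∀ p ∈ πs, p.Palindrome) ∧
      (∀ e N, F ≤ e → E.IsPath e N → E.word (E.n - 2 - e) N ∈ πs) ∧
      ∀ (πs' : List (List α)) (M' : ℕ) (F' : ℤ), 0 ≤ F' → F' < E.n → E.f F' = E.f F →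
        πs'.length + 1 = as.length → (∀ p ∈ πs', p.Palindrome) →
        E.word F' M' = interleave as πs' → M' ≤ M ∧ (M' = M → πs' = πs) := by
  induction as with
  | nil =>
    intro F hF₀ hFn _ _ has
    exact absurd ((has (E.f F)).2 ⟨F, le_refl F, hFn, rfl⟩) (by simp)
  | cons a as ih =>
    intro F hF₀ hFn hlo hsort has
    have hsort' := List.pairwise_cons.1 hsort
    have hfF : E.f F = a := by
      obtain ⟨i, hi, hin, hia⟩ := (has a).1 (by simp)
      refine le_antisymm (hia ▸ E.mono hF₀ hi hin) ?_
      rcases List.mem_cons.1 ((has (E.f F)).2 ⟨F, le_refl F, hFn, rfl⟩) with h | h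
      · exact h.ge
      · exact (hsort'.1 _ h).le
    have hhi := E.hi_lt hF₀ hFn
    have hFhi := le_hi hF₀ hFn
    have hblock : ∀ {i : ℤ}, 0 ≤ i → i < E.n → (E.f i = a ↔ F ≤ i ∧ i ≤ E.hi F) := by
      intro i hi₀ hin
      rw [← hfF, E.eq_iff hF₀ hFn hi₀ hin, hlo]
    have hTF : E.T F = E.n - 1 - E.hi F := by
      unfold T
      omega
    cases as with
    | nil =>
      have hall : ∀ {i : ℤ}, F ≤ i → i < E.n → E.f i = a := fun h₁ h₂ => by
        simpa using (has _).2 ⟨_, h₁, h₂, rfl⟩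
      have hlast : E.hi F = E.n - 1 := by
        have := (hblock (i := E.n - 1) (by omega) (by omega)).1 (hall (by omega) (by omega))
        omega
      refine ⟨[], 1, one_pos, ?_, fun t h₁ h₂ => by omega, by simp [word, interleave, hfF], rfl,
        by simp, fun e N he hN => ?_, fun πs' M' F' _ _ _ hlen _ hw => ?_⟩
      · rw [Function.iterate_one, hTF]
        omega
      · have h₁ := hN.isBoundary.lt
        exact absurd ((hall he (by omega)).trans (hall (by omega) h₁).symm) hN.isBoundary.ne
      · obtain rfl : πs' = [] := by simpa using hlen
        have := congrArg List.length hw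
        simp [interleave] at this
        exact ⟨this.le, fun _ => rfl⟩
    | cons b as =>
      have hab : a < b := hsort'.1 b (by simp)
      set e := E.hi F with he
      have hen : e + 1 < E.n := by
        obtain ⟨i, hi, hin, hib⟩ := (has b).1 (by simp)
        have h₁ := (mt (hblock (i := i) (by omega) hin).2) (hib ▸ hab.ne')
        omega
      have hnext : E.f (e + 1) ≠ a := fun h => by
        have := (hblock (by omega) hen).1 h
        omega
      have hfe : E.f e = a := (hblock (by omega) (by omega)).2 ⟨hFhi, le_refl _⟩
      have hbd : E.IsBoundary e := ⟨by omega, hen, by rw [hfe]; exact hnext.symm⟩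
      have has' : ∀ c, c ∈ b :: as ↔ ∃ i, e + 1 ≤ i ∧ i < E.n ∧ E.f i = c := by
        intro c
        constructor
        · intro hc
          obtain ⟨i, hi, hin, hic⟩ := (has c).1 (List.mem_cons_of_mem a hc)
          have h₁ := (mt (hblock (i := i) (by omega) hin).2) (hic ▸ (hsort'.1 c hc).ne')
          exact ⟨i, by omega, hin, hic⟩
        · rintro ⟨i, hi, hin, rfl⟩
          have h₁ := (mt (hblock (i := i) (by omega) hin).1) (by omega)
          exact (List.mem_cons.1 ((has _).2 ⟨i, by omega, hin, rfl⟩)).resolve_left h₁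
      obtain ⟨πs, M, hM, hTM, hpos, hw, hlen, hpal, hmem, huniq⟩ :=
        ih (e + 1) (by omega) hen hbd.lo_succ hsort'.2 has'
      obtain ⟨N, hN⟩ := hE.exists_path hbd
      have hTF' : E.T F = E.n - 2 - e + 1 := by omega
      have hTN : E.T^[N + 1] F = e + 1 := by
        rw [Function.iterate_succ_apply, hTF', hN.iterate_succ]
      have hfb : E.f (e + 1) = b := by
        cases M with
        | zero => omega
        | succ M =>
          obtain ⟨l, hl⟩ := exists_interleave_eq_cons b as πs
          rw [word, hl] at hw
          exact (List.cons.inj hw).1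
      refine ⟨E.word (E.n - 2 - e) N :: πs, M + (N + 1), by omega, ?_, ?_, ?_, ?_, ?_, ?_, ?_⟩
      · rw [Function.iterate_add_apply, hTN, hTM]
      · intro t ht htM
        by_cases htN : t ≤ N + 1
        · obtain ⟨t, rfl⟩ := Nat.exists_eq_add_of_lt ht
          have h₁ := word_eq_of_le (s := t) (by omega) hN.word_eq
          have h₂ := iterate_sub (by omega) (by omega) (by omega) (by omega) h₁
          have h₃ := iterate_mem (E := E) (i := E.n - 2 - e) (by omega) (by omega) t
          rw [zero_add, Function.iterate_succ_apply, hTF']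
          omega
        · have h₁ : t = (t - (N + 1)) + (N + 1) := by omega
          rw [h₁, Function.iterate_add_apply, hTN]
          exact hpos _ (by omega) (by omega)
      · rw [add_comm, word_add, hTN, hw, word, hTF', hfF, ← hN.word_eq]
        simp [interleave]
      · simpa using hlen
      · intro p hp
        rcases List.mem_cons.1 hp with rfl | hp
        · exact hN.palindrome
        · exact hpal p hp
      · intro e' N' he' hN'
        by_cases hee : e + 1 ≤ e'
        · exact List.mem_cons_of_mem _ (hmem e' N' hee hN')
        · have h₁ := hN'.isBoundary.nonneg
          have h₂ := hN'.isBoundary.lt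
          have h₃ : e' = e := by
            by_contra hne
            refine hN'.isBoundary.ne ?_
            rw [(hblock h₁ (by omega)).2 (by omega),
              (hblock (i := e' + 1) (by omega) h₂).2 (by omega)]
          subst h₃
          rw [hN.length_unique hN']
          simp
      · intro πs' M' F' hF'₀ hF'n hF' hlen' hpal' hw'
        cases πs' with
        | nil => simp at hlen'
        | cons p ps =>
          obtain ⟨l, hl⟩ := exists_interleave_eq_cons b as ps
          have hM' : M' = 1 + p.length + (interleave (b :: as) ps).length := by
            have := congrArg List.length hw'
            simp only [length_word, interleave, List.length_cons, List.length_append] at this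
            omega
          set M₂ := (interleave (b :: as) ps).length with hM₂
          rw [hM', word_add, add_comm 1, word, interleave, List.cons_append] at hw'
          obtain ⟨hp, hrest⟩ := List.append_inj (List.cons.inj hw').2 (by simp)
          rw [Function.iterate_succ_apply] at hrest
          have hT₀ := T_nonneg hF'₀ hF'n
          have hTn := T_lt hF'₀ hF'n
          obtain ⟨hG₀, hGn⟩ := iterate_mem hT₀ hTn p.length
          set G := E.T^[p.length] (E.T F') with hG
          have hfG : E.f G = b := by
            have h₁ : M₂ = M₂ - 1 + 1 := by
              rw [hM₂, hl]
              simp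
            rw [h₁, word, hl] at hrest
            exact (List.cons.inj hrest).1
          obtain ⟨hle, heq⟩ := huniq ps M₂ G hG₀ hGn (by rw [hfG, hfb]) (by simpa using hlen')
            (fun r hr => hpal' r (List.mem_cons_of_mem p hr)) hrest
          -- reading the palindrome backwards gives a point before `T F'` with the same coding,
          -- and the path of `e` starts between the two
          have hGe : e < G := by
            by_contra hlt
            have := E.mono hG₀ (not_lt.1 hlt) (by omega)
            rw [hfG, hfe] at this
            exact absurd this (not_le.2 hab)
          have hF'F := ((hblock hF'₀ hF'n).1 (by rw [hF', hfF])).1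
          have hTF'' := T_sub hF₀ hFn hF'₀ hF'n hF'.symm
          have hrev : E.word (E.n - 1 - G) p.length = E.word (E.T F') p.length := by
            rw [hG, ← reverse_word hT₀ hTn, hp]
            exact (hpal' p (by simp)).reverse_eq
          have h₁ := word_eq_of_between (j := E.n - 2 - e) (by omega) (by omega) (by omega) hTn hrev
          have h₂ := word_eq_of_between (j := E.n - 2 - e + 1) (by omega) (by omega) (by omega)
            hTn hrev
          have hpN := hN.le_of_word_eq (h₁.trans h₂.symm)
          refine ⟨by omega, fun hMM => ?_⟩
          have hpN' : p.length = N := by omega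
          rw [heq (by omega), ← hp, ← h₁, hpN']

end Exchange

/-! ### Primitive words and their conjugates -/

variable {α : Type*}

theorem IsPrimitive.ne_nil {w : List α} (hw : IsPrimitive w) : w ≠ [] := by
  rintro rfl
  simpa using hw [] 0 (by simp)

theorem take_mul_of_rotate_eq {w : List α} {p : ℕ} (h : w.rotate p = w) (hp : p ≤ w.length)
    (m : ℕ) (hm : p * m ≤ w.length) :
    w.take (p * m) = (List.replicate m (w.take p)).flatten := by
  induction m with
  | zero => simp
  | succ m ih =>
    have h₁ : w.take (p * m) = (w.drop p).take (p * m) := by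
      conv_lhs => rw [← h, List.rotate_eq_drop_append_take hp]
      rw [List.take_append_of_le_length]
      rw [List.length_drop]
      rw [Nat.mul_succ] at hm
      omega
    rw [List.replicate_succ, List.flatten_cons, ← ih (by rw [Nat.mul_succ] at hm; omega), h₁,
      Nat.mul_succ, add_comm, List.take_add]

/-- A primitive word differs from its nontrivial rotations. -/
theorem IsPrimitive.length_dvd_of_rotate_eq {w : List α} (hw : IsPrimitive w) {k : ℕ}
    (hk : w.rotate k = w) : w.length ∣ k := by
  classical
  have hpos : 0 < w.length := List.length_pos_iff.2 hw.ne_nil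
  have hex : ∃ p, 0 < p ∧ w.rotate p = w := ⟨w.length, hpos, w.rotate_length⟩
  obtain ⟨hp₀, hp⟩ := Nat.find_spec hex
  have hmin := fun m => Nat.find_min (H := hex) (m := m)
  have hle : Nat.find hex ≤ w.length := Nat.find_min' hex ⟨hpos, w.rotate_length⟩
  set p := Nat.find hex
  have hmul : ∀ m, w.rotate (p * m) = w := by
    intro m
    induction m with
    | zero => simp
    | succ m ih => rw [Nat.mul_succ, ← List.rotate_rotate, ih, hp]
  have hdvd : ∀ {l}, w.rotate l = w → p ∣ l := by
    intro l hl
    by_contra hnd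
    refine hmin (l % p) (Nat.mod_lt _ hp₀) ⟨Nat.pos_of_ne_zero fun h => ?_, ?_⟩
    · exact hnd (Nat.dvd_of_mod_eq_zero h)
    · conv_rhs => rw [← hl, ← Nat.div_add_mod l p, ← List.rotate_rotate, hmul]
  obtain ⟨m, hm⟩ := hdvd w.rotate_length
  have h₁ := take_mul_of_rotate_eq hp hle m hm.ge
  rw [← hm, List.take_length] at h₁
  have h₂ := hw _ _ h₁
  rw [hm, h₂, mul_one]
  exact hdvd hk

variable [LinearOrder α]

theorem mem_bwRows {v w : List α} : v ∈ bwRows w ↔ v ~r w := by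
  simp [bwRows, List.mem_cyclicPermutations_iff]

theorem pairwise_bwRows (w : List α) : (bwRows w).Pairwise (· < ·) :=
  (Finset.sortedLT_sort _).pairwise

theorem length_bwRows {w : List α} (hw : IsPrimitive w) : (bwRows w).length = w.length := by
  rw [bwRows, Finset.length_sort, List.toFinset_card_of_nodup,
    List.length_cyclicPermutations_of_ne_nil w hw.ne_nil]
  rw [List.nodup_iff_injective_get]
  intro a b hab
  have ha := a.2.trans_eq (List.length_cyclicPermutations_of_ne_nil w hw.ne_nil)
  have hb := b.2.trans_eq (List.length_cyclicPermutations_of_ne_nil w hw.ne_nil)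
  simp only [List.get_eq_getElem, List.getElem_cyclicPermutations] at hab
  have aux : ∀ {a b : ℕ}, a ≤ b → b < w.length → w.rotate a = w.rotate b → a = b := by
    intro a b hle hb h
    have h₁ : w.rotate (b - a) = w := by
      apply List.rotate_injective a
      simp only [List.rotate_rotate]
      rw [Nat.sub_add_cancel hle, h]
    have h₂ := Nat.eq_zero_of_dvd_of_lt (hw.length_dvd_of_rotate_eq h₁) (by omega)
    omega
  rcases le_total a.1 b.1 with h | h
  · exact Fin.ext (aux h hb hab)
  · exact Fin.ext (aux h ha hab.symm).symm

theorem append_singleton_lt {a : α} : ∀ {u v : List α}, u.length = v.length → u < v →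
    u ++ [a] < v ++ [a]
  | [], [], _, h => absurd h (lt_irrefl _)
  | b :: u, c :: v, hl, h => by
    rw [List.cons_append, List.cons_append, List.cons_lt_cons_iff]
    rcases List.cons_lt_cons_iff.1 h with h | ⟨h₁, h₂⟩
    · exact Or.inl h
    · exact Or.inr ⟨h₁, append_singleton_lt (by simpa using hl) h₂⟩

/-! ### The exchange of a perfectly clustering word -/

/-- A strictly decreasing map of an integer interval to itself is the reflection. -/
theorem eq_reflection_of_strictAnti {l h : ℤ} {P : ℤ → ℤ}
    (hP : ∀ i, l ≤ i → i ≤ h → l ≤ P i ∧ P i ≤ h)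
    (hanti : ∀ i j, l ≤ i → i < j → j ≤ h → P j < P i) {i : ℤ} (hl : l ≤ i) (hh : i ≤ h) :
    P i = l + h - i := by
  have h₁ : ∀ m : ℕ, l + m ≤ h → P (l + m) ≤ h - m := by
    intro m
    induction m with
    | zero => intro hm; simpa using (hP l (by omega) (by omega)).2
    | succ m ih =>
      intro hm
      have := ih (by omega)
      have := hanti (l + m) (l + (m + 1 : ℕ)) (by omega) (by omega) hm
      push_cast at *
      omega
  have h₂ : ∀ m : ℕ, l ≤ h - m → l + m ≤ P (h - m) := by
    intro m
    induction m with
    | zero => intro hm; simpa using (hP h (by omega) (by omega)).1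
    | succ m ih =>
      intro hm
      have := ih (by omega)
      have := hanti (h - (m + 1 : ℕ)) (h - m) hm (by omega) (by omega)
      push_cast at *
      omega
  have h₃ := h₁ (i - l).toNat (by omega)
  have h₄ := h₂ (h - i).toNat (by omega)
  have h₅ : l + ((i - l).toNat : ℤ) = i := by omega
  have h₆ : h - ((h - i).toNat : ℤ) = i := by omega
  rw [h₅] at h₃
  rw [h₆] at h₄
  omega

/-- A permutation that is increasing on each block of `f` and transports `f` to a weakly decreasing
map is the symmetric exchange of the blocks. -/
theorem exists_exchange_of_perm {n : ℕ} (f : Fin n → α) (τ : Equiv.Perm (Fin n))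
    (hf : Monotone f) (hτ : Antitone (f ∘ τ.symm))
    (hord : ∀ i j, f i = f j → i < j → τ i < τ j) (hn : 0 < n) :
    ∃ E : Exchange α, E.n = n ∧
      ∀ i : Fin n, E.f (i : ℕ) = f i ∧ E.T (i : ℕ) = ((τ i : ℕ) : ℤ) := by
  classical
  have hblock : ∀ i : Fin n, ∃ l h : Fin n, ∀ j, f j = f i ↔ l ≤ j ∧ j ≤ h := by
    intro i
    have hne : (Finset.univ.filter fun j => f j = f i).Nonempty := ⟨i, by simp⟩
    have h₁ := (Finset.mem_filter.1 (Finset.min'_mem _ hne)).2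
    have h₂ := (Finset.mem_filter.1 (Finset.max'_mem _ hne)).2
    refine ⟨Finset.min' _ hne, Finset.max' _ hne, fun j => ⟨fun hj => ?_, fun hj => ?_⟩⟩
    · exact ⟨Finset.min'_le _ _ (by simp [hj]), Finset.le_max' _ _ (by simp [hj])⟩
    · exact le_antisymm ((hf hj.2).trans h₂.le) (h₁.ge.trans (hf hj.1))
  choose l h hlh using hblock
  let c : ℤ → Fin n := fun i => ⟨min i.toNat (n - 1), by omega⟩
  have hc : ∀ {i : ℤ}, 0 ≤ i → i < n → ((c i : ℕ) : ℤ) = i := by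
    intro i h₁ h₂
    simp only [c]
    omega
  have hcF : ∀ i : Fin n, c (i : ℕ) = i := by
    intro i
    have := i.2
    ext
    simp only [c]
    omega
  let E : Exchange α :=
    { n := n
      f := fun i => f (c i)
      lo := fun i => (l (c i) : ℕ)
      hi := fun i => (h (c i) : ℕ)
      mono := by
        intro i j h₁ h₂ h₃
        apply hf
        have := hc (i := i) h₁ (by omega)
        have := hc (i := j) (by omega) h₃
        rw [Fin.le_def]
        omega
      lo_nonneg := fun _ _ => by positivity
      hi_lt := fun {i} _ _ => by
        have := (h (c i)).2
        omega
      eq_iff := by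
        intro i j h₁ h₂ h₃ h₄
        have := hc h₃ h₄
        rw [hlh, Fin.le_def, Fin.le_def]
        omega }
  refine ⟨E, rfl, fun i => ⟨congrArg f (hcF i), ?_⟩⟩
  -- `f ∘ τ.symm` read backwards is a weakly increasing rearrangement of `f`, hence equal to `f`
  have hrev : ∀ i, f (τ i).rev = f i := by
    intro i
    have h₁ : Monotone (f ∘ (Fin.revPerm.trans τ.symm : Equiv.Perm (Fin n))) := by
      intro a b hab
      exact hτ (Fin.rev_le_rev.2 hab)
    have h₂ : Monotone (f ∘ (1 : Equiv.Perm (Fin n))) := hf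
    have h₃ := congrFun (Tuple.unique_monotone h₁ h₂) (τ i).rev
    simpa using h₃.symm
  have hval := eq_reflection_of_strictAnti (l := (l i : ℕ)) (h := (h i : ℕ))
    (P := fun j => n - 1 - (τ (c j) : ℕ)) (i := (i : ℕ))
    (by
      intro j h₁ h₂
      have h₃ := (h i).2
      have h₄ := hc (i := j) (by omega) (by omega)
      have h₅ : f (c j) = f i := (hlh i _).2 ⟨by rw [Fin.le_def]; omega, by rw [Fin.le_def]; omega⟩
      obtain ⟨h₆, h₇⟩ := (hlh i _).1 ((hrev (c j)).trans h₅)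
      rw [Fin.le_def, Fin.val_rev] at h₆ h₇
      have := (τ (c j)).2
      omega)
    (by
      intro j k h₁ h₂ h₃
      have h₄ := (h i).2
      have h₅ := hc (i := j) (by omega) (by omega)
      have h₆ := hc (i := k) (by omega) (by omega)
      have h₇ : f (c j) = f i := (hlh i _).2 ⟨by rw [Fin.le_def]; omega, by rw [Fin.le_def]; omega⟩
      have h₈ : f (c k) = f i := (hlh i _).2 ⟨by rw [Fin.le_def]; omega, by rw [Fin.le_def]; omega⟩
      have h₉ := hord (c j) (c k) (h₇.trans h₈.symm) (by rw [Fin.lt_def]; omega)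
      rw [Fin.lt_def] at h₉
      omega)
    (by exact_mod_cast ((hlh i i).1 rfl).1) (by exact_mod_cast ((hlh i i).1 rfl).2)
  rw [hcF] at hval
  simp only [Exchange.T, E, hcF]
  omega

/-- The rows of the Burrows–Wheeler matrix of a perfectly clustering word are the codings of the
orbits of a cyclic symmetric exchange, in their order. -/
theorem IsPerfectlyClustering.exists_exchange {w : List α} (hw : IsPerfectlyClustering w) :
    ∃ E : Exchange α, E.IsCyclic ∧ 0 < E.n ∧ (bwRows w).length = E.n ∧
      ∀ (k : ℕ) (hk : k < (bwRows w).length), (bwRows w)[k] = E.word k E.n := by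
  have hlen := length_bwRows hw.1
  have hpos : 0 < w.length := List.length_pos_iff.2 hw.1.ne_nil
  have hpair := pairwise_bwRows w
  have hlast := hw.2
  rw [bw, List.pairwise_filterMap] at hlast
  have hmem := fun v => mem_bwRows (v := v) (w := w)
  generalize bwRows w = R at *
  have hrowlen : ∀ i : Fin R.length, (R.get i).length = R.length := fun i => by
    rw [hlen, ((hmem _).1 (R.get_mem i)).perm.length_eq]
  have hmono : StrictMono R.get := hpair.sortedLT.strictMono_get
  have hhead : ∀ i, ∃ a u, R.get i = a :: u := by
    intro i
    exact List.exists_cons_of_length_pos (by rw [hrowlen]; omega)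
  choose f tl hrow using hhead
  have htl : ∀ i, (tl i).length + 1 = R.length := fun i => by
    rw [← hrowlen i, hrow, List.length_cons]
  have hnext : ∀ i, ∃ j, R.get j = (R.get i).rotate 1 := fun i =>
    List.mem_iff_get.1 ((hmem _).2
      (((List.IsRotated.forall _ 1)).trans ((hmem _).1 (R.get_mem i))))
  choose τ₀ hτ₀ using hnext
  have hinj : Function.Injective τ₀ := by
    intro i j hij
    apply hmono.injective
    apply List.rotate_injective 1
    simp only [← hτ₀, hij]
  let τ : Equiv.Perm (Fin R.length) := Equiv.ofBijective τ₀ (Finite.injective_iff_bijective.1 hinj)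
  have hτ : ∀ i, R.get (τ i) = tl i ++ [f i] := fun i => by
    change R.get (τ₀ i) = _
    rw [hτ₀, hrow, List.rotate_cons_succ, List.rotate_zero]
  obtain ⟨E, hEn, hE⟩ := exists_exchange_of_perm f τ
    (by
      intro i j hij
      rcases hij.eq_or_lt with rfl | hij
      · exact le_refl _
      · have h₁ := hmono hij
        rw [hrow, hrow, List.cons_lt_cons_iff] at h₁
        rcases h₁ with h₁ | h₁
        · exact h₁.le
        · exact h₁.1.le)
    (by
      intro i j hij
      rcases hij.eq_or_lt with rfl | hij
      · exact le_refl _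
      · have hl : ∀ i, (R.get i).getLast? = some (f (τ.symm i)) := fun i => by
          conv_lhs => rw [← τ.apply_symm_apply i, hτ]
          simp
        exact List.pairwise_iff_get.1 hlast i j hij _ (hl i) _ (hl j))
    (by
      intro i j hf hij
      rw [← hmono.lt_iff_lt, hτ, hτ, hf]
      have h₁ := hmono hij
      rw [hrow, hrow, List.cons_lt_cons_iff] at h₁
      have h₂ := htl i
      have h₃ := htl j
      exact append_singleton_lt (by omega) (h₁.resolve_left hf.not_lt).2)
    (by omega)
  have hword : ∀ (t : ℕ) (i : Fin R.length), t ≤ R.length →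
      E.word (i : ℕ) t = (R.get i).take t := by
    intro t
    induction t with
    | zero => intro i _; simp [Exchange.word]
    | succ t ih =>
      intro i ht
      have h₁ := htl i
      rw [Exchange.word, (hE i).1, (hE i).2, ih _ (by omega), hτ, hrow, List.take_succ_cons,
        List.take_append_of_le_length (by omega)]
  have hwordn : ∀ i : Fin R.length, E.word (i : ℕ) E.n = R.get i := fun i => by
    rw [hEn, hword _ _ le_rfl, List.take_of_length_le (hrowlen i).le]
  have hiter : ∀ (t : ℕ) (i : Fin R.length), ∃ j : Fin R.length,
      E.T^[t] (i : ℕ) = (j : ℕ) ∧ R.get j = (R.get i).rotate t := by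
    intro t
    induction t with
    | zero => intro i; exact ⟨i, rfl, by simp⟩
    | succ t ih =>
      intro i
      obtain ⟨j, h₁, h₂⟩ := ih (τ i)
      refine ⟨j, by rw [Function.iterate_succ_apply, (hE i).2, h₁], ?_⟩
      rw [h₂, add_comm, ← List.rotate_rotate, ← hτ₀]
      rfl
  have hfin : ∀ {i : ℤ}, 0 ≤ i → i < E.n → ∃ k : Fin R.length, i = (k : ℕ) := fun {i} h₁ h₂ =>
    ⟨⟨i.toNat, by omega⟩, by simp [h₁]⟩
  refine ⟨E, ⟨?_, ?_, ?_⟩, by omega, hEn.symm, fun k hk => (hwordn ⟨k, hk⟩).symm⟩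
  · intro i h₁ h₂
    obtain ⟨k, rfl⟩ := hfin h₁ h₂
    obtain ⟨j, h₃, h₄⟩ := hiter E.n k
    rw [hEn, ← hrowlen k, List.rotate_length] at h₄
    rw [h₃, hmono.injective h₄]
  · intro i h₁ h₂
    obtain ⟨k, rfl⟩ := hfin h₁ h₂
    let z : Fin R.length := ⟨0, by omega⟩
    obtain ⟨t, ht⟩ := ((hmem _).1 (R.get_mem z)).trans ((hmem _).1 (R.get_mem k)).symm
    obtain ⟨j, h₃, h₄⟩ := hiter (t % R.length) z
    refine ⟨t % R.length, by rw [hEn]; exact Nat.mod_lt _ (by omega), ?_⟩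
    have h₅ : (R.get z).rotate (t % R.length) = (R.get z).rotate t := by
      conv_rhs => rw [← List.rotate_mod, hrowlen z]
    rw [h₅, ht] at h₄
    rw [hmono.injective h₄] at h₃
    exact h₃
  · intro i j h₁ h₂ h₃ h₄ h
    obtain ⟨k, rfl⟩ := hfin h₁ h₂
    obtain ⟨m, rfl⟩ := hfin h₃ h₄
    rw [hwordn, hwordn] at h
    rw [hmono.injective h]

/-! ### Special palindromic factorizations of Lyndon words -/

theorem Exchange.mem_word {E : Exchange α} {a : α} (i : ℤ) (t : ℕ) :
    a ∈ E.word i t ↔ ∃ s < t, E.f (E.T^[s] i) = a := by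
  induction t generalizing i with
  | zero => simp [Exchange.word]
  | succ t ih =>
    rw [Exchange.word, List.mem_cons, ih]
    constructor
    · rintro (rfl | ⟨s, hs, rfl⟩)
      · exact ⟨0, by omega, rfl⟩
      · exact ⟨s + 1, by omega, rfl⟩
    · rintro ⟨_ | s, hs, rfl⟩
      · exact Or.inl rfl
      · exact Or.inr ⟨s, by omega, rfl⟩

/-- The coding of the first point has exactly one special palindromic factorization, whose
palindromes are read along the paths. -/
theorem Exchange.IsCyclic.exists_isSpecialPalindromicFactorization {E : Exchange α}
    (hE : E.IsCyclic) (hn : 0 < E.n) :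
    ∃ π, IsSpecialPalindromicFactorization (E.word 0 E.n) π ∧
      (∀ π', IsSpecialPalindromicFactorization (E.word 0 E.n) π' → π' = π) ∧
      ∀ e N, E.IsPath e N → E.word (E.n - 2 - e) N ∈ π := by
  classical
  have hn' : (0 : ℤ) < E.n := by exact_mod_cast hn
  have hlo : E.lo 0 = 0 := le_antisymm (lo_le le_rfl hn') (E.lo_nonneg le_rfl hn')
  obtain ⟨π, M, hM, hTM, hpos, hw, hlen, hpal, hmem, huniq⟩ :=
    hE.exists_factorization (letters (E.word 0 E.n)) 0 le_rfl hn' hlo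
      (Finset.sortedLT_sort _).pairwise (by
        intro a
        rw [letters, Finset.mem_sort, List.mem_toFinset, mem_word]
        constructor
        · rintro ⟨s, -, rfl⟩
          obtain ⟨h₁, h₂⟩ := iterate_mem le_rfl hn' s
          exact ⟨_, h₁, h₂, rfl⟩
        · rintro ⟨i, h₁, h₂, rfl⟩
          obtain ⟨t, ht, rfl⟩ := hE.exists_iterate h₁ h₂
          exact ⟨t, ht, rfl⟩)
  -- `M` is the first return time to `0`
  have hMn : M = E.n := by
    apply le_antisymm
    · by_contra hlt
      have h₁ := hpos E.n hn (not_le.1 hlt)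
      rw [hE.iterate_n le_rfl hn'] at h₁
      exact lt_irrefl _ h₁
    · have hper : Function.IsPeriodicPt E.T M 0 := hTM
      have hsub : Finset.Ico (0 : ℤ) E.n ⊆ (Finset.range M).image fun t => E.T^[t] 0 := by
        intro i hi
        obtain ⟨h₁, h₂⟩ := Finset.mem_Ico.1 hi
        obtain ⟨t, -, rfl⟩ := hE.exists_iterate h₁ h₂
        exact Finset.mem_image.2
          ⟨t % M, Finset.mem_range.2 (Nat.mod_lt _ hM), hper.iterate_mod_apply t⟩
      have := (Finset.card_le_card hsub).trans Finset.card_image_le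
      simpa using this
  subst hMn
  refine ⟨π, ⟨hlen, hw, hpal⟩, fun π' hπ' => ?_, fun e N hN =>
    hmem e N hN.isBoundary.nonneg hN⟩
  exact (huniq π' E.n 0 le_rfl hn' rfl hπ'.length_eq hπ'.palindrome hπ'.eq_interleave).2 rfl

end ClusteringWord

/-- Let `w` be a perfectly clustering word and `z` its Lyndon conjugate. Then `z` has exactly one
special palindromic factorization, and any two consecutive rows of the Burrows–Wheeler matrix
of `w` are `y m x` and `y m̃ x` with `x y` one of the palindromes of that factorization. -/
theorem mainTheorem2 {α : Type*} [LinearOrder α] (w z : List α)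
    (hw : ClusteringWord.IsPerfectlyClustering w)
    (hz : ClusteringWord.IsLyndon z) (hzw : z ~r w) :
    ∃ π : List (List α),
      ClusteringWord.IsSpecialPalindromicFactorization z π ∧
      (∀ π' : List (List α),
        ClusteringWord.IsSpecialPalindromicFactorization z π' → π' = π) ∧
      ∀ (i : ℕ) (hi : i + 1 < (ClusteringWord.bwRows w).length),
        ∃ x y m : List α,
          (ClusteringWord.bwRows w)[i] = y ++ m ++ x ∧
          (ClusteringWord.bwRows w)[i + 1] = y ++ m.reverse ++ x ∧
          x ++ y ∈ π := by
  obtain ⟨E, hE, hn, hlen, hrow⟩ := hw.exists_exchange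
  have hz₀ : z = E.word 0 E.n := by
    have h₀ : 0 < (ClusteringWord.bwRows w).length := by omega
    have h₁ := hrow 0 h₀
    rw [Nat.cast_zero] at h₁
    rw [← h₁]
    apply le_antisymm
    · exact hz.2 _ ((ClusteringWord.mem_bwRows.1 (List.getElem_mem h₀)).trans hzw.symm)
    · obtain ⟨j, hj, rfl⟩ := List.mem_iff_getElem.1 (ClusteringWord.mem_bwRows.2 hzw)
      rcases Nat.eq_zero_or_pos j with rfl | hj₀
      · exact le_rfl
      · exact (List.pairwise_iff_getElem.1 (ClusteringWord.pairwise_bwRows w) 0 j h₀ hj hj₀).le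
  obtain ⟨π, hπ, huniq, hmem⟩ := hE.exists_isSpecialPalindromicFactorization hn
  rw [← hz₀] at hπ huniq
  refine ⟨π, hπ, huniq, fun i hi => ?_⟩
  obtain ⟨e, N, hN, x, y, m, h₁, h₂, h₃⟩ := hE.exists_word_eq (i := (i : ℤ)) (by omega) (by omega)
  refine ⟨x, y, m, (hrow i (by omega)).trans h₁, ?_, h₃ ▸ hmem e N hN⟩
  rw [hrow (i + 1) hi, ← h₂]
  push_cast
  rfl
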